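/- Let $r\ge 2$ be an integer and $\alpha\ge 1$ a rational number. For a finite $r$-uniform hypergraph $A$ (a graph if $r=2$), with vertex set $V(A)$ and set of hyperedges $R(A)$, put $\delta_\alpha(A)=\alpha\,|V(A)|-|R(A)|$. By $A\subseteq B$ we mean that $A$ is an induced substructure of $B$. For finite $A\subseteq B$ write $A\leqslant_\alpha B$ if $\delta_\alpha(C)\ge\delta_\alpha(A)$ for every $C$ with $A\subseteq C\subseteq B$. For finite $A\subseteq N$ with $N$ infinite, write $A\leqslant_\alpha N$ if $A\leqslant_\alpha B$ for every finite $B$ with $A\subseteq B\subseteq N$. Let $\mathcal K_\alpha^{\prec}$ be the class of all finite $r$-uniform hypergraphs $A$ with $\delta_\alpha(B)\ge 0$ for every $B\subseteq A$, each equipped with an arbitrary linear order $\prec$ of its vertices; for ordered hypergraphs, $\leqslant_\alpha$ means that the order is induced and that $\leqslant_\alpha$ holds between the underlying hypergraphs. Let $\mathbf M$ be the generic structure of $(\mathcal K_\alpha^{\prec},\leqslant_\alpha)$, that is, the countable linearly ordered $r$-uniform hypergraph, unique up to isomorphism, such that 1. the finite structures that embed in $\mathbf M$ are exactly the members of $\mathcal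 K_\alpha^{\prec}$; 2. $\mathbf M=\bigcup_{i\in\mathbb N}A_i$ for finite $A_0\leqslant_\alpha A_1\leqslant_\alpha A_2\leqslant_\alpha\cdots$; 3. if $A\leqslant_\alpha\mathbf M$ is finite and $A\leqslant_\alpha B\in\mathcal K_\alpha^{\prec}$, then there is an embedding $\Gamma:B\to\mathbf M$ that is the identity on $A$ and satisfies $\Gamma[B]\leqslant_\alpha\mathbf M$. Then the group $\mathrm{Aut}(\mathbf M)$ of automorphisms of $\mathbf M$ (preserving hyperedges and order), with the topology of pointwise convergence on the discrete set $\mathbf M$, is not extremely amenable: there is a continuous action of $\mathrm{Aut}(\mathbf M)$ on a nonempty compact Hausdorff space without a fixed point. -/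

import Mathlib

/-- A topological group `G` is extremely amenable if every `G`-flow, i.e. every (jointly)
continuous action of `G` on a nonempty compact Hausdorff space, has a fixed point. -/
def IsExtremelyAmenable.{u} (G : Type u) [Group G] [TopologicalSpace G]
    [IsTopologicalGroup G] : Prop :=
  ∀ (X : Type u) [TopologicalSpace X] [CompactSpace X] [T2Space X] [Nonempty X]
    [MulAction G X] [ContinuousSMul G X], ∃ x : X, ∀ g : G, g • x = x

/-- An ordered `r`-uniform hypergraph with vertex set `V`: a symmetric irreflexive `r`-ary relation,
given by its set of hyperedges (`r`-element sets of vertices), together with a strict linear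
order `lt` of `V`. For `r = 2` it is an ordered simple graph. -/
structure OrderedHypergraph (r : ℕ) (V : Type*) where
  edges : Set (Finset V)
  card_of_mem : ∀ e ∈ edges, e.card = r
  lt : V → V → Prop
  isStrictTotalOrder : IsStrictTotalOrder V lt

namespace OrderedHypergraph

variable {r : ℕ} {V W : Type*}

open Classical in
/-- The predimension of the substructure induced on the finite set `A`:
`δ(A) = α · |A| - (number of hyperedges contained in A)`. -/
noncomputable def predim (H : OrderedHypergraph r V) (α : ℚ) (A : Finset V) : ℚ :=
  α * (A.card : ℚ) - ((A.powerset.filter fun e => e ∈ H.edges).card : ℚ)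

/-- `A ≤ B` for finite sets of vertices: `A ⊆ B` and `δ(C) ≥ δ(A)` whenever `A ⊆ C ⊆ B`.
The order plays no role. -/
def ClosedIn (H : OrderedHypergraph r V) (α : ℚ) (A B : Finset V) : Prop :=
  A ⊆ B ∧ ∀ C : Finset V, A ⊆ C → C ⊆ B → H.predim α A ≤ H.predim α C

/-- `A ≤ H`: the finite set `A` is closed in every finite set of vertices containing it. -/
def Closed (H : OrderedHypergraph r V) (α : ℚ) (A : Finset V) : Prop :=
  ∀ B : Finset V, A ⊆ B → H.ClosedIn α A B

/-- Membership of a finite ordered hypergraph in the ordered ab-initio class: every set of vertices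
has nonnegative predimension. -/
def InClass (H : OrderedHypergraph r V) (α : ℚ) : Prop :=
  ∀ A : Finset V, 0 ≤ H.predim α A

/-- `f` is an embedding: an isomorphism (of ordered hypergraphs) onto an induced substructure. -/
def IsEmbedding (H : OrderedHypergraph r V) (K : OrderedHypergraph r W) (f : V ↪ W) : Prop :=
  (∀ e : Finset V, e.map f ∈ K.edges ↔ e ∈ H.edges) ∧ ∀ x y : V, K.lt (f x) (f y) ↔ H.lt x y

/-- `f` is a closed embedding of the finite structure `H` into `K`: an embedding whose image is
closed in `K`. -/
def IsClosedEmbedding [Fintype V] (H : OrderedHypergraph r V) (K : OrderedHypergraph r W)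
    (α : ℚ) (f : V ↪ W) : Prop :=
  H.IsEmbedding K f ∧ K.Closed α (Finset.univ.map f)

/-- `M` is the (countable) generic structure of the ordered ab-initio class. -/
structure IsGeneric (M : OrderedHypergraph r V) (α : ℚ) : Prop where
  /-- The finite structures that embed in `M` are exactly those of the class. -/
  age : ∀ (F : Type) [Fintype F] (K : OrderedHypergraph r F),
    K.InClass α ↔ ∃ f : F ↪ V, K.IsEmbedding M f
  /-- `M` is the union of a chain of finite sets, each closed in the next one. -/
  chain : ∃ A : ℕ → Finset V, (∀ i, M.ClosedIn α (A i) (A (i + 1))) ∧ ∀ x : V, ∃ i, x ∈ A i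
  /-- If `A` is closed in `B`, with `B` in the class, then every closed embedding of `A` in `M`
  extends to a closed embedding of `B` in `M`. -/
  extension : ∀ (F F' : Type) [Fintype F] [Fintype F'] (A : OrderedHypergraph r F)
    (B : OrderedHypergraph r F') (i : F ↪ F') (f : F ↪ V), B.InClass α →
    A.IsClosedEmbedding B α i → A.IsClosedEmbedding M α f →
    ∃ g : F' ↪ V, B.IsClosedEmbedding M α g ∧ ∀ x : F, g (i x) = f x

/-- The automorphism group: all permutations of the vertices that preserve the hyperedges and
the order in both directions. -/
def aut (H : OrderedHypergraph r V) : Subgroup (Equiv.Perm V) where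
  carrier := {g | H.IsEmbedding H g.toEmbedding}
  one_mem' := by
    refine ⟨fun e => ?_, fun x y => Iff.rfl⟩
    have h : e.map (Equiv.toEmbedding (1 : Equiv.Perm V)) = e := Finset.map_refl
    rw [h]
  mul_mem' := by
    rintro g h ⟨hg, hg'⟩ ⟨hh, hh'⟩
    refine ⟨fun e => ?_, fun x y => ?_⟩
    · rw [← hh e, ← hg (e.map h.toEmbedding), Finset.map_map]
      rfl
    · exact (hg' (h x) (h y)).trans (hh' x y)
  inv_mem' := by
    rintro g ⟨hg, hg'⟩
    refine ⟨fun e => ?_, fun x y => ?_⟩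
    · rw [← hg (e.map _), Finset.map_map]
      have h : e.map ((Equiv.toEmbedding g⁻¹).trans g.toEmbedding) = e := by ext x; simp
      rw [h]
    · rw [← hg' (Equiv.toEmbedding g⁻¹ x) (Equiv.toEmbedding g⁻¹ y)]
      simp

/-- The topology of pointwise convergence on the automorphism group: the topology induced by the
product topology on `V → V`, where `V` is discrete. -/
instance autTopology (H : OrderedHypergraph r V) : TopologicalSpace H.aut :=
  TopologicalSpace.induced (fun (g : H.aut) (x : V) => (g : Equiv.Perm V) x)
    (@Pi.topologicalSpace V (fun _ => V) fun _ => ⊥)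

theorem continuous_apply_aut (H : OrderedHypergraph r V) (x : V) :
    @Continuous H.aut V _ ⊥ (fun g => (g : Equiv.Perm V) x) := by
  let : TopologicalSpace V := ⊥
  exact (continuous_apply x).comp continuous_induced_dom

theorem isOpen_apply_aut (H : OrderedHypergraph r V) (x y : V) :
    IsOpen {g : H.aut | (g : Equiv.Perm V) x = y} := by
  let : TopologicalSpace V := ⊥
  have : DiscreteTopology V := ⟨rfl⟩
  exact (isOpen_discrete {y}).preimage (continuous_apply_aut H x)

theorem continuous_aut_iff (H : OrderedHypergraph r V) {X : Type*} [TopologicalSpace X] (f : X → H.aut)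
    (h : ∀ x y, IsOpen {a | (f a : Equiv.Perm V) x = y}) : Continuous f := by
  let : TopologicalSpace V := ⊥
  have : DiscreteTopology V := ⟨rfl⟩
  rw [continuous_induced_rng]
  refine continuous_pi fun x => continuous_discrete_rng.2 fun y => h x y

instance autIsTopologicalGroup (H : OrderedHypergraph r V) : IsTopologicalGroup H.aut where
  continuous_mul := by
    refine continuous_aut_iff H _ fun x y => ?_
    have : {a : H.aut × H.aut | ((a.1 * a.2 : H.aut) : Equiv.Perm V) x = y} =
      ⋃ z, {g : H.aut | (g : Equiv.Perm V) z = y} ×ˢ {g : H.aut | (g : Equiv.Perm V) x = z} := by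
      ext a; simp
    rw [this]
    exact isOpen_iUnion fun z => (isOpen_apply_aut H z y).prod (isOpen_apply_aut H x z)
  continuous_inv := by
    refine continuous_aut_iff H _ fun x y => ?_
    have : {a : H.aut | ((a⁻¹ : H.aut) : Equiv.Perm V) x = y} = {g : H.aut | (g : Equiv.Perm V) y = x} := by
      ext a
      simp only [Set.mem_ofPred_eq, InvMemClass.coe_inv]
      exact Equiv.Perm.inv_eq_iff_eq.trans eq_comm
    rw [this]; exact isOpen_apply_aut H y x

end OrderedHypergraph

/-! ### Predimension and closed sets -/

namespace OrderedHypergraph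

variable {r : ℕ} {V W : Type*} {H : OrderedHypergraph r V} {K : OrderedHypergraph r W} {α : ℚ}

/-! Nonnegative predimension bounds the number of hyperedges inside a finite `A` by `α * |A|`, so by
Hall's theorem each hyperedge can be assigned to one of its vertices, with at most `p ≥ α`
hyperedges per vertex, told apart by colours (`InClass.exists_injective`). Such coloured assignments
form a nonempty compact invariant space, and extreme amenability would yield an invariant one
(`exists_invariant_colouring`). Closed hyperedges form a single orbit (`exists_aut_apply_eq`), and
the order makes automorphisms match `i`-th vertices. An invariant assignment therefore gives all
closed hyperedges the same colour at their `i`-th vertex, nonzero for some `i`. But two distinct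
closed hyperedges share their `i`-th vertex (`exists_closed_edges`), where nonzero colours must
differ. -/

/-- The structure induced on `V` by an injection into the vertex set of `K`. -/
def comap (K : OrderedHypergraph r W) (f : V ↪ W) : OrderedHypergraph r V where
  edges := {e | e.map f ∈ K.edges}
  card_of_mem e he := by rw [← K.card_of_mem _ he, Finset.card_map]
  lt x y := K.lt (f x) (f y)
  isStrictTotalOrder :=
    have := K.isStrictTotalOrder
    (RelEmbedding.preimage f K.lt).isStrictTotalOrder

theorem isEmbedding_comap (K : OrderedHypergraph r W) (f : V ↪ W) :
    (K.comap f).IsEmbedding K f :=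
  ⟨fun _ => Iff.rfl, fun _ _ => Iff.rfl⟩

theorem IsEmbedding.comap_eq {f : V ↪ W} (h : H.IsEmbedding K f) : K.comap f = H := by
  obtain ⟨E, _, l, _⟩ := H
  have hE : {e : Finset V | e.map f ∈ K.edges} = E := Set.ext h.1
  have hl : (fun x y => K.lt (f x) (f y)) = l := funext₂ fun x y => propext (h.2 x y)
  subst hE hl
  rfl

theorem predim_empty (H : OrderedHypergraph r V) (hr : r ≠ 0) (α : ℚ) : H.predim α ∅ = 0 := by
  have : (∅ : Finset V) ∉ H.edges := fun h => hr (H.card_of_mem _ h).symm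
  simp [predim, Finset.filter_singleton, this]

/-- Cardinality is modular, while a hyperedge meeting both `A \ B` and `B \ A` can count for the
union only. -/
theorem predim_union_add_inter_le [DecidableEq V] (H : OrderedHypergraph r V) (α : ℚ)
    (A B : Finset V) :
    H.predim α (A ∪ B) + H.predim α (A ∩ B) ≤ H.predim α A + H.predim α B := by
  classical
  have h₁ : ((A ∪ B).card : ℚ) + (A ∩ B).card = A.card + B.card :=
    mod_cast Finset.card_union_add_card_inter A B
  set E : Finset V → Finset (Finset V) := fun C => C.powerset.filter (· ∈ H.edges)
  have h₂ : E A ∪ E B ⊆ E (A ∪ B) := by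
    intro e
    simp only [E, Finset.mem_union, Finset.mem_filter, Finset.mem_powerset]
    rintro (h | h)
    · exact ⟨h.1.trans Finset.subset_union_left, h.2⟩
    · exact ⟨h.1.trans Finset.subset_union_right, h.2⟩
  have h₃ : E A ∩ E B ⊆ E (A ∩ B) := by
    intro e
    simp only [E, Finset.mem_inter, Finset.mem_filter, Finset.mem_powerset]
    exact fun h => ⟨Finset.subset_inter h.1.1 h.2.1, h.1.2⟩
  have h₄ : ((E A).card : ℚ) + (E B).card ≤ (E (A ∪ B)).card + (E (A ∩ B)).card := by
    have := Finset.card_union_add_card_inter (E A) (E B)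
    have := Finset.card_le_card h₂
    have := Finset.card_le_card h₃
    norm_cast
    omega
  have h₅ : ∀ C, H.predim α C = α * C.card - (E C).card := fun C => by
    simp only [predim, E]
  simp only [h₅]
  linear_combination h₄ + α * h₁

theorem IsEmbedding.predim_map {f : V ↪ W} (h : H.IsEmbedding K f) (α : ℚ) (A : Finset V) :
    K.predim α (A.map f) = H.predim α A := by
  classical
  have : (A.map f).powerset.filter (· ∈ K.edges) =
      (A.powerset.filter (· ∈ H.edges)).map (Finset.mapEmbedding f).toEmbedding := by
    ext e
    simp only [Finset.mem_filter, Finset.mem_powerset, Finset.subset_map_iff, Finset.mem_map,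
      RelEmbedding.coe_toEmbedding, Finset.mapEmbedding_apply]
    constructor
    · rintro ⟨⟨u, hu, rfl⟩, he⟩
      exact ⟨u, ⟨hu, (h.1 u).1 he⟩, rfl⟩
    · rintro ⟨u, ⟨hu, he⟩, rfl⟩
      exact ⟨⟨u, hu, rfl⟩, (h.1 u).2 he⟩
  have h₂ := congrArg Finset.card this
  rw [Finset.card_map] at h₂
  unfold predim
  rw [Finset.card_map]
  congr! 2

theorem closed_iff {A : Finset V} :
    H.Closed α A ↔ ∀ C, A ⊆ C → H.predim α A ≤ H.predim α C :=
  ⟨fun h C hC => (h C hC).2 C hC subset_rfl, fun h _ hB => ⟨hB, fun C hC _ => h C hC⟩⟩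

/-- By submodularity, passing from `C ∩ B` to `C` adds at least as much as passing from `B` to `C ∪
B`. -/
theorem Closed.predim_inter_le [DecidableEq V] {B : Finset V} (h : H.Closed α B) (C : Finset V) :
    H.predim α (C ∩ B) ≤ H.predim α C := by
  have h₁ := H.predim_union_add_inter_le α C B
  have h₂ := closed_iff.1 h (C ∪ B) Finset.subset_union_right
  linarith

theorem ClosedIn.predim_inter_le [DecidableEq V] {B D : Finset V} (h : H.ClosedIn α B D)
    {C : Finset V} (hC : C ⊆ D) : H.predim α (C ∩ B) ≤ H.predim α C := by
  have h₁ := H.predim_union_add_inter_le α C B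
  have h₂ := h.2 (C ∪ B) Finset.subset_union_right (Finset.union_subset hC h.1)
  linarith

theorem ClosedIn.trans {A B C : Finset V} (h₁ : H.ClosedIn α A B) (h₂ : H.ClosedIn α B C) :
    H.ClosedIn α A C := by
  classical
  refine ⟨h₁.1.trans h₂.1, fun D hA hD => ?_⟩
  exact (h₁.2 (D ∩ B) (Finset.subset_inter hA h₁.1) Finset.inter_subset_right).trans
    (h₂.predim_inter_le hD)

theorem IsEmbedding.closed_of_map {f : V ↪ W} (h : H.IsEmbedding K f) {A : Finset V}
    (hA : K.Closed α (A.map f)) : H.Closed α A := by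
  refine closed_iff.2 fun C hC => ?_
  rw [← h.predim_map, ← h.predim_map]
  exact closed_iff.1 hA _ (Finset.map_subset_map.2 hC)

theorem IsClosedEmbedding.closed_map [Fintype V] {f : V ↪ W} (h : H.IsClosedEmbedding K α f)
    {A : Finset V} (hA : H.Closed α A) : K.Closed α (A.map f) := by
  classical
  refine closed_iff.2 fun C hC => ?_
  obtain ⟨D, -, hD⟩ := Finset.subset_map_iff.1
    (Finset.inter_subset_right : C ∩ Finset.univ.map f ⊆ Finset.univ.map f)
  have hAD : A ⊆ D := by
    rw [← Finset.map_subset_map (f := f), ← hD]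
    exact Finset.subset_inter hC (Finset.map_subset_map.2 A.subset_univ)
  calc K.predim α (A.map f) = H.predim α A := h.1.predim_map α A
    _ ≤ H.predim α D := closed_iff.1 hA D hAD
    _ = K.predim α (C ∩ Finset.univ.map f) := by rw [hD, h.1.predim_map]
    _ ≤ K.predim α C := h.2.predim_inter_le C

namespace IsGeneric

variable {M : OrderedHypergraph r V}

theorem inClass (hM : M.IsGeneric α) : M.InClass α := by
  intro A
  have hf := M.isEmbedding_comap (A.equivFin.symm.toEmbedding.trans (Function.Embedding.subtype _))
  have := (hM.age _ _).2 ⟨_, hf⟩ Finset.univ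
  rw [← hf.predim_map] at this
  convert this
  ext x
  simp only [Finset.mem_map, Finset.mem_univ, true_and]
  exact ⟨fun hx => ⟨A.equivFin ⟨x, hx⟩, by simp⟩, by rintro ⟨y, rfl⟩; simp⟩

theorem closed_empty (hM : M.IsGeneric α) (hr : r ≠ 0) : M.Closed α ∅ :=
  closed_iff.2 fun C _ => by
    rw [M.predim_empty hr]
    exact hM.inClass C

theorem exists_closed_superset (hM : M.IsGeneric α) (S : Finset V) :
    ∃ T, S ⊆ T ∧ M.Closed α T := by
  classical
  obtain ⟨A, hA, hV⟩ := hM.chain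
  have hle : ∀ i k, M.ClosedIn α (A i) (A (i + k)) := by
    intro i k
    induction k with
    | zero => exact ⟨subset_rfl, fun C h₁ h₂ => by rw [subset_antisymm h₁ h₂]⟩
    | succ k ih => exact ih.trans (hA _)
  have hmono : Monotone A := monotone_nat_of_le_succ fun i => (hA i).1
  have hcov : ∀ S : Finset V, ∃ i, S ⊆ A i := by
    intro S
    choose n hn using hV
    exact ⟨S.sup n, fun x hx => hmono (Finset.le_sup hx) (hn x)⟩
  obtain ⟨i, hi⟩ := hcov S
  refine ⟨A i, hi, closed_iff.2 fun C hC => ?_⟩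
  obtain ⟨j, hj⟩ := hcov C
  exact (hle i j).2 C hC (hj.trans (hmono (Nat.le_add_left j i)))

theorem countable (hM : M.IsGeneric α) : Countable V := by
  obtain ⟨A, -, hV⟩ := hM.chain
  have : (Set.univ : Set V) = ⋃ i, (A i : Set V) := by
    ext x
    simpa using hV x
  rw [← Set.countable_univ_iff, this]
  exact Set.countable_iUnion fun i => (A i).countable_toSet

end IsGeneric

end OrderedHypergraph

/-! ### Homogeneity by back-and-forth -/

namespace OrderedHypergraph

variable {r : ℕ} {V : Type*} {α : ℚ} {M : OrderedHypergraph r V}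

/-- An isomorphism between two finite closed substructures of `M`, presented by enumerations
of both of them. -/
structure PartialAut (M : OrderedHypergraph r V) (α : ℚ) where
  n : ℕ
  f : Fin n ↪ V
  g : Fin n ↪ V
  comap_eq : M.comap f = M.comap g
  closed_f : M.Closed α (Finset.univ.map f)
  closed_g : M.Closed α (Finset.univ.map g)

namespace PartialAut

/-- The graph of a partial automorphism. -/
def graph (p : PartialAut M α) : Set (V × V) :=
  Set.range fun i => (p.f i, p.g i)

/-- Not antisymmetric: one graph has several enumerations. -/
instance : Preorder (PartialAut M α) := Preorder.lift graph

/-- The inverse partial automorphism. -/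
def symm (p : PartialAut M α) : PartialAut M α :=
  ⟨p.n, p.g, p.f, p.comap_eq.symm, p.closed_g, p.closed_f⟩

theorem symm_le_symm {p q : PartialAut M α} (h : p ≤ q) : p.symm ≤ q.symm := by
  rintro _ ⟨i, rfl⟩
  obtain ⟨j, hj⟩ := h ⟨i, rfl⟩
  exact ⟨j, congrArg Prod.swap hj⟩

/-- The old domain is closed in any closed finite `T` containing it and `x`, so the extension
property carries `p.g` over to `T`. -/
theorem exists_le_mem_domain (hM : M.IsGeneric α) (p : PartialAut M α) (x : V) :
    ∃ q, p ≤ q ∧ ∃ i, q.f i = x := by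
  classical
  obtain ⟨T, hT, hTc⟩ := hM.exists_closed_superset (insert x (Finset.univ.map p.f))
  let f' : Fin T.card ↪ V := T.equivFin.symm.toEmbedding.trans (Function.Embedding.subtype _)
  have hf' : ∀ y ∈ T, ∃ i, f' i = y := fun y hy => ⟨T.equivFin ⟨y, hy⟩, by simp [f']⟩
  have hrange : Finset.univ.map f' = T := by
    ext y
    simp only [Finset.mem_map, Finset.mem_univ, true_and]
    exact ⟨by rintro ⟨i, rfl⟩; simp [f'], hf' y⟩
  choose i hi using fun k => hf' (p.f k) (hT (by simp))
  let ι : Fin p.n ↪ Fin T.card := ⟨i, fun a b hab => p.f.injective (by rw [← hi, ← hi, hab])⟩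
  have hι : ι.trans f' = p.f := Function.Embedding.ext hi
  have hemb := M.isEmbedding_comap f'
  have hιe : (M.comap p.f).IsEmbedding (M.comap f') ι := by
    rw [← hι]
    exact ⟨fun e => by simp [comap, Finset.map_map], fun _ _ => Iff.rfl⟩
  have hιc : (M.comap f').Closed α (Finset.univ.map ι) := by
    refine hemb.closed_of_map ?_
    rw [Finset.map_map, hι]
    exact p.closed_f
  have hg : (M.comap p.f).IsClosedEmbedding M α p.g := by
    rw [p.comap_eq]
    exact ⟨M.isEmbedding_comap _, p.closed_g⟩
  obtain ⟨g', hg', hext⟩ := hM.extension _ _ _ _ ι p.g ((hM.age _ _).2 ⟨f', hemb⟩) ⟨hιe, hιc⟩ hg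
  refine ⟨⟨_, f', g', hg'.1.comap_eq.symm, hrange.symm ▸ hTc, hg'.2⟩, ?_,
    hf' x (hT (Finset.mem_insert_self _ _))⟩
  rintro _ ⟨k, rfl⟩
  exact ⟨ι k, Prod.ext (hi k) (hext k)⟩

theorem exists_le_mem_range (hM : M.IsGeneric α) (p : PartialAut M α) (x : V) :
    ∃ q, p ≤ q ∧ ∃ i, q.g i = x := by
  obtain ⟨q, hq, i, hi⟩ := exists_le_mem_domain hM p.symm x
  exact ⟨q.symm, symm_le_symm hq, i, hi⟩

/-- Every isomorphism between finite closed substructures of a generic structure extends to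
an automorphism. -/
theorem exists_aut (hM : M.IsGeneric α) (p : PartialAut M α) :
    ∃ σ : M.aut, ∀ i, (σ : Equiv.Perm V) (p.f i) = p.g i := by
  classical
  have := hM.countable
  have := Encodable.ofCountable V
  -- Countably many cofinal conditions, one for each point in the domain and in the range; a single
  -- ideal meets them all.
  let D : V ⊕ V → Order.Cofinal (PartialAut M α) := Sum.elim
    (fun x => ⟨{q | ∃ i, q.f i = x}, fun q =>
      let ⟨q', h, h'⟩ := exists_le_mem_domain hM q x; ⟨q', h', h⟩⟩)
    (fun x => ⟨{q | ∃ i, q.g i = x}, fun q =>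
      let ⟨q', h, h'⟩ := exists_le_mem_range hM q x; ⟨q', h', h⟩⟩)
  let I := Order.idealOfCofinals p D
  have hdom : ∀ x, ∃ y, ∃ q ∈ I, (x, y) ∈ q.graph := fun x => by
    obtain ⟨q, ⟨i, hi⟩, hq⟩ := Order.cofinal_meets_idealOfCofinals p D (Sum.inl x)
    exact ⟨q.g i, q, hq, i, by simp [hi]⟩
  have hran : ∀ y, ∃ x, ∃ q ∈ I, (x, y) ∈ q.graph := fun x => by
    obtain ⟨q, ⟨i, hi⟩, hq⟩ := Order.cofinal_meets_idealOfCofinals p D (Sum.inr x)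
    exact ⟨q.f i, q, hq, i, by simp [hi]⟩
  choose s hs using hdom
  choose t ht using hran
  have hfin : ∀ S : Finset (V × V), (∀ z ∈ S, ∃ q ∈ I, z ∈ q.graph) →
      ∃ q ∈ I, ∀ z ∈ S, z ∈ q.graph := by
    intro S
    induction S using Finset.induction_on with
    | empty => exact fun _ => ⟨p, Order.mem_idealOfCofinals p D, by simp⟩
    | insert z S _ ih =>
      intro h
      obtain ⟨q, hq, hz⟩ := h z (by simp)
      obtain ⟨q', hq', hS⟩ := ih fun w hw => h w (by simp [hw])
      obtain ⟨q'', hq'', h₁, h₂⟩ := I.directed q hq q' hq'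
      refine ⟨q'', hq'', fun w hw => ?_⟩
      obtain rfl | hw := Finset.mem_insert.1 hw
      · exact h₁ hz
      · exact h₂ (hS w hw)
  have hpair : ∀ z w, (∃ q ∈ I, z ∈ q.graph) → (∃ q ∈ I, w ∈ q.graph) →
      (z.1 = w.1 ↔ z.2 = w.2) := by
    intro z w hz hw
    obtain ⟨q, -, hq⟩ := hfin {z, w} (by simp [hz, hw])
    obtain ⟨i, rfl⟩ := hq z (by simp)
    obtain ⟨j, rfl⟩ := hq w (by simp)
    simp
  let σ : Equiv.Perm V := ⟨s, t, fun x => (hpair _ _ (ht (s x)) (hs x)).2 rfl,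
    fun y => (hpair _ _ (hs (t y)) (ht y)).1 rfl⟩
  have hσ : ∀ x, ∃ q ∈ I, (x, σ x) ∈ q.graph := hs
  -- On a finite set `σ` agrees with a single partial automorphism, hence preserves hyperedges and
  -- order.
  have hon : ∀ S : Finset V, ∃ q : PartialAut M α, ∃ S' : Finset (Fin q.n), S = S'.map q.f ∧
      ∀ i ∈ S', σ (q.f i) = q.g i := by
    intro S
    obtain ⟨q, -, hq⟩ := hfin (S.image fun x => (x, σ x)) (by simpa using fun x _ => hσ x)
    have hq' : ∀ x ∈ S, ∃ i, q.f i = x ∧ q.g i = σ x := fun x hx => by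
      simpa [graph] using hq (x, σ x) (Finset.mem_image_of_mem _ hx)
    obtain ⟨S', -, rfl⟩ := Finset.subset_map_iff.1 (show S ⊆ Finset.univ.map q.f from
      fun x hx => by obtain ⟨i, hi, -⟩ := hq' x hx; simp [← hi])
    refine ⟨q, S', rfl, fun i hi => ?_⟩
    obtain ⟨j, hj, hj'⟩ := hq' (q.f i) (Finset.mem_map_of_mem _ hi)
    rw [← hj', q.f.injective hj]
  refine ⟨⟨σ, fun e => ?_, fun x y => ?_⟩, fun i => ?_⟩
  · obtain ⟨q, e', rfl, he⟩ := hon e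
    have : (e'.map q.f).map σ.toEmbedding = e'.map q.g := by
      rw [Finset.map_map, Finset.map_eq_image, Finset.map_eq_image]
      exact Finset.image_congr he
    rw [this]
    exact (Set.ext_iff.1 (congrArg edges q.comap_eq) e').symm
  · obtain ⟨q, e, he, hq⟩ := hon {x, y}
    obtain ⟨i, hi, rfl⟩ := Finset.mem_map.1 (he ▸ Finset.mem_insert_self x {y})
    obtain ⟨j, hj, rfl⟩ := Finset.mem_map.1
      (he ▸ Finset.mem_insert_of_mem (Finset.mem_singleton_self y))
    change M.lt (σ (q.f i)) (σ (q.f j)) ↔ _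
    rw [hq i hi, hq j hj]
    exact (iff_of_eq (congrFun₂ (congrArg lt q.comap_eq) i j)).symm
  · exact (hpair (p.f i, σ (p.f i)) (p.f i, p.g i) (hσ _)
      ⟨p, Order.mem_idealOfCofinals p D, i, rfl⟩).1 rfl

end PartialAut

end OrderedHypergraph

/-! ### Invariant colourings from extreme amenability -/

/-- For an extremely amenable group acting on `T` with open stabilizers and transporters,
every nonempty closed invariant set of colourings of `T` contains an invariant colouring. -/
theorem IsExtremelyAmenable.exists_invariant_colouring.{u} {G T : Type u} {K : Type} [Group G]
    [TopologicalSpace G] [IsTopologicalGroup G] [MulAction G T] [TopologicalSpace K]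
    [CompactSpace K] [T2Space K] (hG : IsExtremelyAmenable G)
    (hopen : ∀ t u : T, IsOpen {g : G | g • t = u}) {Y : Set (T → K)} (hY : IsClosed Y)
    (hne : Y.Nonempty) (hinv : ∀ g : G, ∀ f ∈ Y, (fun t => f (g⁻¹ • t)) ∈ Y) :
    ∃ f ∈ Y, ∀ (g : G) (t : T), f (g • t) = f t := by
  let : MulAction G Y :=
    { smul := fun g f => ⟨fun t => f.1 (g⁻¹ • t), hinv g f.1 f.2⟩
      one_smul := fun f => Subtype.ext <| funext fun t => by
        change f.1 ((1 : G)⁻¹ • t) = f.1 t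
        simp
      mul_smul := fun g h f => Subtype.ext <| funext fun t => by
        change f.1 ((g * h)⁻¹ • t) = f.1 (h⁻¹ • g⁻¹ • t)
        rw [mul_inv_rev, mul_smul] }
  have : ContinuousSMul G Y := by
    refine ⟨(continuous_pi fun t => ⟨fun U hU => ?_⟩).subtype_mk _⟩
    -- Joint continuity: `g⁻¹ • t` is locally constant in `g`.
    have : (fun a : G × Y => a.2.1 (a.1⁻¹ • t)) ⁻¹' U =
        ⋃ u, {g : G | g⁻¹ • t = u} ×ˢ {f : Y | f.1 u ∈ U} := by
      ext a; simp
    rw [this]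
    exact isOpen_iUnion fun u => ((hopen t u).preimage continuous_inv).prod
      (hU.preimage ((continuous_apply u).comp continuous_subtype_val))
  have : CompactSpace Y := isCompact_iff_compactSpace.1 hY.isCompact
  have : Nonempty Y := hne.to_subtype
  obtain ⟨f, hf⟩ := hG Y
  refine ⟨f.1, f.2, fun g t => ?_⟩
  have : f.1 (g⁻¹⁻¹ • t) = f.1 t := congrFun (congrArg Subtype.val (hf g⁻¹)) t
  rwa [inv_inv] at this

namespace OrderedHypergraph

variable {r : ℕ} {V : Type*} {α : ℚ} {M : OrderedHypergraph r V}

/-- Any two closed embeddings of a finite structure in a generic structure differ by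
an automorphism. -/
theorem IsGeneric.exists_aut_apply_eq (hM : M.IsGeneric α) {n : ℕ}
    {K : OrderedHypergraph r (Fin n)} {f g : Fin n ↪ V} (hf : K.IsClosedEmbedding M α f)
    (hg : K.IsClosedEmbedding M α g) : ∃ σ : M.aut, ∀ i, σ • f i = g i :=
  PartialAut.exists_aut hM ⟨n, f, g, hf.1.comap_eq.trans hg.1.comap_eq.symm, hf.2, hg.2⟩

/-! ### Two closed hyperedges with a common vertex -/

/-- The structure on `r` points with a single hyperedge. -/
def singleEdge (r : ℕ) : OrderedHypergraph r (Fin r) where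
  edges := {Finset.univ}
  card_of_mem := by rintro _ rfl; simp
  lt := (· < ·)
  isStrictTotalOrder := inferInstance

/-- The structure on `r + 1` points with two hyperedges, the complements of the consecutive
points `j` and `j + 1`. -/
def doubleEdge (j : Fin r) : OrderedHypergraph r (Fin (r + 1)) where
  edges := {e | ∃ p, (p = j.castSucc ∨ p = j.succ) ∧ e = Finset.univ.map (Fin.succAboveEmb p)}
  card_of_mem := by rintro _ ⟨p, -, rfl⟩; simp
  lt := (· < ·)
  isStrictTotalOrder := inferInstance

theorem isEmbedding_succAboveEmb (j : Fin r) {p : Fin (r + 1)}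
    (hp : p = j.castSucc ∨ p = j.succ) :
    (singleEdge r).IsEmbedding (doubleEdge j) (Fin.succAboveEmb p) := by
  refine ⟨fun e => ⟨fun he => ?_, ?_⟩, fun x y => Fin.succAbove_lt_succAbove_iff⟩
  · have := (doubleEdge j).card_of_mem _ he
    rw [Finset.card_map] at this
    exact Finset.eq_univ_of_card e (by simpa using this)
  · rintro rfl
    exact ⟨p, hp, rfl⟩

/-- In `doubleEdge j`, the hyperedges contained in `A` number at most two, and at most one unless
`A` is everything. -/
theorem le_predim_doubleEdge (hα : 1 ≤ α) (j : Fin r) (A : Finset (Fin (r + 1))) :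
    0 ≤ (doubleEdge j).predim α A ∧ (r ≤ A.card → α * r - 1 ≤ (doubleEdge j).predim α A) := by
  classical
  have hr : (1 : ℚ) ≤ r := mod_cast j.pos
  have hαr : 1 ≤ α * r := one_le_mul_of_one_le_of_one_le hα hr
  obtain ⟨s, hs⟩ : ∃ s, s = A.powerset.filter (· ∈ (doubleEdge j).edges) := ⟨_, rfl⟩
  have hpre : (doubleEdge j).predim α A = α * A.card - s.card := by
    simp only [predim, hs]
  have hmem : ∀ e ∈ s, e ⊆ A ∧ e ∈ (doubleEdge j).edges := fun e he => by
    simpa [hs] using he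
  suffices 0 ≤ α * A.card - s.card ∧ (r ≤ A.card → α * r - 1 ≤ α * A.card - s.card) by
    rwa [hpre]
  obtain hA | hA := lt_or_ge r A.card
  · have hle : s.card ≤ 2 := by
      refine (Finset.card_le_card (t := {Finset.univ.map (Fin.succAboveEmb j.castSucc),
        Finset.univ.map (Fin.succAboveEmb j.succ)}) fun e he => ?_).trans Finset.card_le_two
      obtain ⟨p, rfl | rfl, rfl⟩ := (hmem e he).2 <;> simp
    have h₁ : (s.card : ℚ) ≤ 2 := mod_cast hle
    have h₂ : (r : ℚ) + 1 ≤ A.card := mod_cast hA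
    -- Here `α ≥ 1` enters: the extra vertex pays for the second hyperedge.
    have : α * r - 1 ≤ α * A.card - s.card := by nlinarith
    exact ⟨by linarith, fun _ => this⟩
  -- With at most `r` vertices, `A` can contain no hyperedge other than itself.
  · have hle : ∀ e ∈ s, e = A := fun e he => Finset.eq_of_subset_of_card_le (hmem e he).1
      (hA.trans_eq ((doubleEdge j).card_of_mem e (hmem e he).2).symm)
    have h₁ : (s.card : ℚ) ≤ 1 := mod_cast Finset.card_le_one.2 fun a ha b hb =>
      (hle a ha).trans (hle b hb).symm
    have h₂ : r ≤ A.card → α * r - 1 ≤ α * A.card - s.card := fun h => by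
      rw [le_antisymm hA h]
      linarith
    refine ⟨?_, h₂⟩
    obtain rfl | ⟨e, he⟩ := s.eq_empty_or_nonempty
    · have : 0 ≤ α * A.card := by positivity
      simpa
    · have := h₂ (by rw [← hle e he, (doubleEdge j).card_of_mem e (hmem e he).2])
      linarith

theorem closed_doubleEdge (hα : 1 ≤ α) (j : Fin r) {p : Fin (r + 1)}
    (hp : p = j.castSucc ∨ p = j.succ) :
    (doubleEdge j).Closed α (Finset.univ.map (Fin.succAboveEmb p)) := by
  classical
  refine closed_iff.2 fun C hC => ?_
  have hcard : (Finset.univ.map (Fin.succAboveEmb p)).card = r := by simp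
  refine le_trans ?_ ((le_predim_doubleEdge hα j C).2
    (hcard.symm.le.trans (Finset.card_le_card hC)))
  unfold predim
  rw [hcard, sub_le_sub_iff_left, Nat.one_le_cast, Nat.one_le_iff_ne_zero,
    Finset.card_ne_zero]
  exact ⟨_, Finset.mem_filter.2 ⟨Finset.mem_powerset_self _, p, hp, rfl⟩⟩

/-- For every `i`, a generic structure has two closed hyperedges sharing their `i`-th vertex. -/
theorem IsGeneric.exists_closed_edges (hM : M.IsGeneric α) (hr : 2 ≤ r) (hα : 1 ≤ α) (i : Fin r) :
    ∃ f g : Fin r ↪ V, (singleEdge r).IsClosedEmbedding M α f ∧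
      (singleEdge r).IsClosedEmbedding M α g ∧ f i = g i ∧
      Finset.univ.map f ≠ Finset.univ.map g := by
  have : Nontrivial (Fin r) := Fin.nontrivial_iff_two_le.2 hr
  -- The two hyperedges of `doubleEdge j` have the same `k`-th point for every `k ≠ j`.
  obtain ⟨j, hj⟩ := exists_ne i
  have hclass : (doubleEdge j).InClass α := fun A => (le_predim_doubleEdge hα j A).1
  let z : Fin 0 ↪ Fin (r + 1) := ⟨Fin.elim0, fun a => a.elim0⟩
  let y : Fin 0 ↪ V := ⟨Fin.elim0, fun a => a.elim0⟩
  have hempty : M.comap y = (doubleEdge j).comap z := by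
    refine IsEmbedding.comap_eq ⟨fun e => ?_, fun x => x.elim0⟩
    rw [Finset.eq_empty_of_isEmpty e]
    exact ⟨fun h => absurd (M.card_of_mem _ h) (by simp; omega),
      fun h => absurd ((doubleEdge j).card_of_mem _ h) (by simp; omega)⟩
  -- The empty set is closed on both sides, so `M` contains a closed copy of `doubleEdge j`.
  obtain ⟨Γ, hΓ, -⟩ := hM.extension _ _ ((doubleEdge j).comap z) (doubleEdge j) z y hclass
    ⟨isEmbedding_comap _ _, closed_iff.2 fun C _ => by
      simpa [predim_empty _ (by omega : r ≠ 0)] using hclass C⟩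
    ⟨hempty ▸ isEmbedding_comap _ _, by simpa using hM.closed_empty (by omega)⟩
  have key : ∀ p, p = j.castSucc ∨ p = j.succ →
      (singleEdge r).IsClosedEmbedding M α ((Fin.succAboveEmb p).trans Γ) := fun p hp => by
    have h := isEmbedding_succAboveEmb j hp
    refine ⟨⟨fun e => ?_, fun a b => (hΓ.1.2 _ _).trans (h.2 a b)⟩, ?_⟩
    · rw [← Finset.map_map]
      exact (hΓ.1.1 _).trans (h.1 e)
    · rw [← Finset.map_map]
      exact hΓ.closed_map (closed_doubleEdge hα j hp)
  refine ⟨_, _, key _ (Or.inl rfl), key _ (Or.inr rfl), congrArg Γ ?_, fun h => ?_⟩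
  · obtain hij | hij := lt_or_gt_of_ne hj
    · simp [Fin.succAbove_castSucc_of_le _ _ hij.le, Fin.succAbove_succ_of_lt _ _ hij]
    · simp [Fin.succAbove_castSucc_of_lt _ _ hij, Fin.succAbove_succ_of_le _ _ hij.le]
  · rw [← Finset.map_map, ← Finset.map_map, Finset.map_inj] at h
    have h₁ : j.castSucc ∈ Finset.univ.map (Fin.succAboveEmb j.succ) := by
      obtain ⟨k, hk⟩ := Fin.exists_succAbove_eq (Fin.castSucc_lt_succ (i := j)).ne
      exact Finset.mem_map.2 ⟨k, Finset.mem_univ k, hk⟩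
    rw [← h] at h₁
    obtain ⟨k, -, hk⟩ := Finset.mem_map.1 h₁
    exact Fin.succAbove_ne _ _ hk

/-! ### The compact space of incidence colourings -/

/-- If all predimensions are nonnegative and `α ≤ p`, then the hyperedges can be assigned
to vertices on them, with colours from `Fin p`, such that distinct hyperedges assigned to
the same vertex have distinct colours. -/
theorem InClass.exists_injective (hM : M.InClass α) {p : ℕ} (hp : α ≤ p) :
    ∃ F : M.edges → V × Fin p, F.Injective ∧ ∀ e, (F e).1 ∈ e.1 := by
  classical
  -- Hall's condition for the candidate sets `e × Fin p`: the hyperedges in `s` lie in their union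
  -- `A`, so they number at most `α * |A| ≤ p * |A|`.
  obtain ⟨F, hF, hmem⟩ := (Finset.all_card_le_biUnion_card_iff_exists_injective
    (fun e : M.edges => e.1 ×ˢ (Finset.univ : Finset (Fin p)))).1 fun s => by
      let A := s.biUnion Subtype.val
      have h₁ : s.biUnion (fun e => e.1 ×ˢ (Finset.univ : Finset (Fin p))) =
          A ×ˢ Finset.univ := by
        ext x; simp [A]
      have h₂ : s.map (Function.Embedding.subtype _) ⊆
          A.powerset.filter (· ∈ M.edges) := fun e he => by
        obtain ⟨e, hs, rfl⟩ := Finset.mem_map.1 he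
        exact Finset.mem_filter.2
          ⟨Finset.mem_powerset.2 (Finset.subset_biUnion_of_mem Subtype.val hs), e.2⟩
      have h₃ := Finset.card_le_card h₂
      rw [Finset.card_map] at h₃
      have h₄ : ((A.powerset.filter (· ∈ M.edges)).card : ℚ) ≤ α * A.card := by
        have := hM A
        unfold predim at this
        convert sub_nonneg.1 this
      have h₅ : α * A.card ≤ p * A.card := by gcongr
      rw [h₁, Finset.card_product, Finset.card_univ, Fintype.card_fin, mul_comm]
      exact h₃.trans (mod_cast h₄.trans h₅)
  exact ⟨F, hF, fun e => (Finset.mem_product.1 (hmem e)).1⟩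

open Pointwise in
theorem isOpen_smul_prod_eq [DecidableEq V] (M : OrderedHypergraph r V) (t u : V × Finset V) :
    IsOpen {g : M.aut | g • t = u} := by
  refine isOpen_iff_forall_mem_open.2 fun g hg => ⟨⋂ x ∈ insert t.1 t.2,
    {h : M.aut | (h : Equiv.Perm V) x = (g : Equiv.Perm V) x}, fun h hh => ?_,
    isOpen_biInter_finset fun x _ => isOpen_apply_aut M x _, by simp⟩
  have hh' : ∀ x ∈ insert t.1 t.2, h • x = g • x := fun x hx => Set.mem_iInter₂.1 hh x hx
  rw [Set.mem_ofPred_eq, ← show g • t = u from hg]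
  refine Prod.ext (hh' _ (Finset.mem_insert_self _ _)) (Finset.image_congr fun x hx => ?_)
  exact hh' x (Finset.mem_insert_of_mem hx)

/-- The colourings `f` of the pairs `(v, e)`, with colours in `Fin (p + 1)`, such that every
hyperedge `e` has a vertex `v` with `f (v, e) ≠ 0`, and the nonzero colours of distinct hyperedges
at the same vertex are distinct. -/
def incidenceColourings (M : OrderedHypergraph r V) (p : ℕ) :
    Set (V × Finset V → Fin (p + 1)) :=
  {f | (∀ e ∈ M.edges, ∃ v ∈ e, f (v, e) ≠ 0) ∧
    ∀ v, ∀ e ∈ M.edges, ∀ e' ∈ M.edges, e ≠ e' → f (v, e) = f (v, e') → f (v, e) = 0}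

/-- Each condition involves finitely many coordinates; finiteness of `e` makes the existential one a
finite union of closed sets. -/
theorem isClosed_incidenceColourings (M : OrderedHypergraph r V) (p : ℕ) :
    IsClosed (M.incidenceColourings p) := by
  have hc : ∀ t u : V × Finset V, ∀ S : Set (Fin (p + 1) × Fin (p + 1)),
      IsClosed {f : V × Finset V → Fin (p + 1) | (f t, f u) ∈ S} := fun t u S =>
    (isClosed_discrete S).preimage ((continuous_apply t).prodMk (continuous_apply u))
  have h₁ : M.incidenceColourings p =
      (⋂ e ∈ M.edges, ⋃ v ∈ e, {f | (f (v, e), f (v, e)) ∈ {c : Fin (p + 1) × _ | c.1 ≠ 0}}) ∩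
      ⋂ v, ⋂ e ∈ M.edges, ⋂ e' ∈ M.edges, ⋂ (_ : e ≠ e'),
        {f | (f (v, e), f (v, e')) ∈ {c : Fin (p + 1) × _ | c.1 = c.2 → c.1 = 0}} := by
    ext f
    simp [incidenceColourings]
  rw [h₁]
  refine IsClosed.inter ?_ ?_
  · exact isClosed_biInter fun e _ => e.finite_toSet.isClosed_biUnion fun v _ => hc _ _ _
  · exact isClosed_iInter fun v => isClosed_biInter fun e _ => isClosed_biInter fun e' _ =>
      isClosed_iInter fun _ => hc _ _ _

theorem InClass.incidenceColourings_nonempty (hM : M.InClass α) {p : ℕ} (hp : α ≤ p) :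
    (M.incidenceColourings p).Nonempty := by
  classical
  obtain ⟨F, hF, hmem⟩ := hM.exists_injective hp
  -- Colour `0` means that `e` is not assigned to `v`; actual colours are shifted by `succ`.
  let f : V × Finset V → Fin (p + 1) := fun t =>
    if h : t.2 ∈ M.edges then if (F ⟨t.2, h⟩).1 = t.1 then (F ⟨t.2, h⟩).2.succ else 0 else 0
  have hf : ∀ v e (h : e ∈ M.edges) (h₀ : f (v, e) ≠ 0), F ⟨e, h⟩ = (v, (f (v, e)).pred h₀) := by
    intro v e h hne
    have h₁ : (F ⟨e, h⟩).1 = v := by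
      by_contra h'
      exact hne (by simp [f, h, h'])
    refine Prod.ext h₁ ?_
    rw [eq_comm, Fin.pred_eq_iff_eq_succ]
    simp [f, h, h₁]
  refine ⟨f, fun e he => ⟨_, hmem ⟨e, he⟩, by simp [f, he]⟩, fun v e he e' he' hne heq => ?_⟩
  by_contra h₀
  have h₁ := hf v e he h₀
  have h₂ := hf v e' he' (heq ▸ h₀)
  simp only [← heq] at h₂
  exact hne (congrArg Subtype.val (hF (h₁.trans h₂.symm)))

open Pointwise in
theorem smul_mem_edges_iff [DecidableEq V] (g : M.aut) (e : Finset V) :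
    g • e ∈ M.edges ↔ e ∈ M.edges := by
  rw [← g.2.1 e, Finset.map_eq_image]
  rfl

open Pointwise in
theorem comp_smul_mem_incidenceColourings [DecidableEq V] {p : ℕ} (g : M.aut)
    {f : V × Finset V → Fin (p + 1)} (hf : f ∈ M.incidenceColourings p) :
    (fun t => f (g • t)) ∈ M.incidenceColourings p := by
  refine ⟨fun e he => ?_, fun v e he e' he' hne => ?_⟩
  · obtain ⟨v, hv, h⟩ := hf.1 (g • e) ((smul_mem_edges_iff g e).2 he)
    obtain ⟨w, hw, rfl⟩ := Finset.mem_smul_finset.1 hv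
    exact ⟨w, hw, h⟩
  · exact hf.2 (g • v) (g • e) ((smul_mem_edges_iff g e).2 he) (g • e')
      ((smul_mem_edges_iff g e').2 he') fun h => hne (smul_left_cancel g h)

end OrderedHypergraph

open OrderedHypergraph Pointwise in
/-- For every arity `r ≥ 2` and every rational `α ≥ 1`, the automorphism group of the ordered
generic structure obtained from the predimension `α · |A| - |R(A)|` is not extremely amenable. -/
theorem mainTheorem8 (r : ℕ) (hr : 2 ≤ r) (α : ℚ) (hα : 1 ≤ α) (V : Type*)
    (M : OrderedHypergraph r V) (hM : M.IsGeneric α) :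
    ¬ IsExtremelyAmenable M.aut := by
  classical
  intro hG
  obtain ⟨p, hp⟩ := exists_nat_ge α
  obtain ⟨f, hf, hinv⟩ := hG.exists_invariant_colouring (isOpen_smul_prod_eq M)
    (isClosed_incidenceColourings M p) (hM.inClass.incidenceColourings_nonempty hp)
    fun g _ h => comp_smul_mem_incidenceColourings g⁻¹ h
  -- The index `0` is arbitrary: any closed hyperedge will do.
  obtain ⟨u, -, hu, -⟩ := hM.exists_closed_edges hr hα ⟨0, by omega⟩
  have hedge : ∀ w : Fin r ↪ V, (singleEdge r).IsClosedEmbedding M α w →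
      Finset.univ.map w ∈ M.edges := fun w hw => (hw.1.1 _).2 rfl
  obtain ⟨v, hv, hne⟩ := hf.1 _ (hedge u hu)
  obtain ⟨i, -, rfl⟩ := Finset.mem_map.1 hv
  -- Some automorphism maps `u` to `w` index by index, and `f` is invariant.
  have htrans : ∀ w : Fin r ↪ V, (singleEdge r).IsClosedEmbedding M α w →
      f (w i, Finset.univ.map w) = f (u i, Finset.univ.map u) := by
    intro w hw
    obtain ⟨σ, hσ⟩ := hM.exists_aut_apply_eq hu hw
    rw [← hinv σ (u i, _), Prod.smul_mk, hσ]
    congr 2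
    ext x
    simp [Finset.mem_smul_finset, hσ]
  obtain ⟨w, w', hw, hw', heq, hdist⟩ := hM.exists_closed_edges hr hα i
  have h₀ := hf.2 (w i) _ (hedge w hw) _ (hedge w' hw') hdist
    (by rw [htrans w hw, heq, htrans w' hw'])
  exact hne ((htrans w hw).symm.trans h₀)
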